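/- Let $\mathbb F$ be a field of characteristic $p\ge 0$, let $n\ge 1$, and let $U_1,\dots,U_n$ be finite sets with $|U_h|>1$ for every $h$. Let $X=U_1\times\cdots\times U_n$ and $E=\{0,1\}^n$. For $g\in E$ let $R_g$ be the set of all pairs $(y,z)\in X\times X$ such that, for every $h$, $y_h=z_h$ if $g_h=0$ and $y_h\ne z_h$ if $g_h=1$. The factorial scheme $\mathfrak S=(X,\{R_g\}_{g\in E})$ is the direct product of the trivial association schemes on $U_1,\dots,U_n$. For $g\in E$ its valency is $k_g=|\{z\in X:(y,z)\in R_g\}|$, which does not depend on $y\in X$; for an integer $m\ge 0$ the scheme is called $m'$-valenced if $m\nmid k_g$ for all $g\in E$. Fix $x\in X$. For $g\in E$ let $A_g$ be the $X\times X$ matrix over $\mathbb F$ whose $(y,z)$-entry is $1$ if $(y,z)\in R_g$ and $0$ otherwise, and let $E_g^*(x)$ be the diagonal $X\times X$ matrix over $\mathbb F$ whose $(y,y)$-entry is $1$ if $(x,y)\in R_g$ and $0$ otherwise. The Terwilliger $\mathbb F$-algebra $\mathbb T=\mathbb T(x)$ is the unital $\mathbb F$-subalgebra of the algebra of all $X\times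 X$ matrices over $\mathbb F$ generated by all $A_g$ and $E_g^*(x)$ with $g\in E$. Then $\mathbb T$ is a semisimple algebra if and only if $\mathfrak S$ is $p'$-valenced. Moreover, $\mathbb T$ is semisimple if and only if $p\nmid\prod_{h=1}^n(|U_h|-1)$. (Here $0$ divides only $0$, so for $p=0$ both conditions hold.) -/

import Mathlib

/-- An association scheme on the finite set `X` with relations indexed by the finite set `E`.
The relations `R g` are the (nonempty, pairwise disjoint) classes of a partition of `X × X`; hence
`zero`, `star g` are uniquely determined by `R`, and `X`, `E` are nonempty. -/
structure AssociationScheme (X E : Type*) [Finite X] [Finite E] where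
  R : E → Set (X × X)
  nonempty : ∀ g, (R g).Nonempty
  partition : ∀ z : X × X, ∃! g, z ∈ R g
  zero : E
  R_zero : R zero = {z | z.1 = z.2}
  star : E → E
  R_star : ∀ g, R (star g) = {z | (z.2, z.1) ∈ R g}
  regular : ∀ (g h i : E) (x y x' y' : X), (x, y) ∈ R i → (x', y') ∈ R i →
    {a | (x, a) ∈ R g ∧ (a, y) ∈ R h}.ncard = {a | (x', a) ∈ R g ∧ (a, y') ∈ R h}.ncard

namespace AssociationScheme

section Basic

variable {X E : Type*} [Finite X] [Finite E] (S : AssociationScheme X E)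

/-- The intersection number `p_{g,h}^i`, computed at an arbitrarily chosen pair in `R i`. -/
noncomputable def intersectionNumber (g h i : E) : ℕ :=
  {a | ((S.nonempty i).choose.1, a) ∈ S.R g ∧ (a, (S.nonempty i).choose.2) ∈ S.R h}.ncard

/-- The intersection number does not depend on the chosen pair. -/
theorem intersectionNumber_eq (g h i : E) {x y : X} (hxy : (x, y) ∈ S.R i) :
    S.intersectionNumber g h i = {a | (x, a) ∈ S.R g ∧ (a, y) ∈ S.R h}.ncard :=
  S.regular g h i _ _ x y (S.nonempty i).choose_spec hxy

/-- The valency `k_g = p_{g,g*}^0`. -/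
noncomputable def valency (g : E) : ℕ := S.intersectionNumber g (S.star g) S.zero

/-- The scheme is `m'`-valenced: `m` divides no valency. -/
def IsCoprimeValenced (m : ℕ) : Prop := ∀ g, ¬ m ∣ S.valency g

end Basic

section Terwilliger

variable {X E : Type*} [Fintype X] [DecidableEq X] [Finite E] (F : Type*) [Field F]
  (S : AssociationScheme X E)

open Classical in
/-- The adjacency matrix `A_g` over `F`. -/
noncomputable def adjacencyMatrix (g : E) : Matrix X X F :=
  Matrix.of fun y z => if (y, z) ∈ S.R g then 1 else 0

open Classical in
/-- The dual idempotent `E_g^*(x)` over `F`. -/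
noncomputable def dualIdempotent (x : X) (g : E) : Matrix X X F :=
  Matrix.diagonal fun y => if (x, y) ∈ S.R g then 1 else 0

/-- The Terwilliger `F`-algebra of `S` with respect to `x`: the subalgebra of the full matrix
algebra generated by all adjacency matrices and all dual idempotents. -/
noncomputable def terwilligerAlgebra (x : X) : Subalgebra F (Matrix X X F) :=
  Algebra.adjoin F (Set.range (S.adjacencyMatrix F) ∪ Set.range (S.dualIdempotent F x))

end Terwilliger

/-- The direct product of a finite family of schemes. -/
def directProduct {ι : Type*} [Finite ι] {X E : ι → Type*} [∀ h, Finite (X h)]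
    [∀ h, Finite (E h)] (S : ∀ h, AssociationScheme (X h) (E h)) :
    AssociationScheme (∀ h, X h) (∀ h, E h) where
  R i := {z | ∀ h, (z.1 h, z.2 h) ∈ (S h).R (i h)}
  nonempty i := ⟨(fun h => ((S h).nonempty (i h)).choose.1,
    fun h => ((S h).nonempty (i h)).choose.2), fun h => ((S h).nonempty (i h)).choose_spec⟩
  partition z := by
    choose g hg hu using fun h => (S h).partition (z.1 h, z.2 h)
    exact ⟨g, hg, fun g' hg' => funext fun h => hu h _ (hg' h)⟩
  zero h := (S h).zero
  R_zero := by
    ext z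
    simp only [(S _).R_zero, Set.mem_ofPred_eq]
    exact funext_iff.symm
  star i h := (S h).star (i h)
  R_star i := by
    ext z
    simp [(S _).R_star]
  regular g h i x y x' y' hxy hxy' := by
    cases nonempty_fintype ι
    have key : ∀ x y : (∀ h, X h),
        {a : ∀ h, X h | (x, a) ∈ {z : (∀ h, X h) × (∀ h, X h) |
              ∀ j, (z.1 j, z.2 j) ∈ (S j).R (g j)} ∧
            (a, y) ∈ {z : (∀ h, X h) × (∀ h, X h) | ∀ j, (z.1 j, z.2 j) ∈ (S j).R (h j)}}.ncard
          = ∏ j, {a | (x j, a) ∈ (S j).R (g j) ∧ (a, y j) ∈ (S j).R (h j)}.ncard := by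
      intro x y
      have e : {a : ∀ h, X h | (x, a) ∈ {z : (∀ h, X h) × (∀ h, X h) |
              ∀ j, (z.1 j, z.2 j) ∈ (S j).R (g j)} ∧
            (a, y) ∈ {z : (∀ h, X h) × (∀ h, X h) | ∀ j, (z.1 j, z.2 j) ∈ (S j).R (h j)}}
          = Set.univ.pi fun j => {a | (x j, a) ∈ (S j).R (g j) ∧ (a, y j) ∈ (S j).R (h j)} := by
        ext a
        simp [Set.mem_pi, forall_and]
      rw [e, Set.ncard_def, Set.encard_pi_eq_prod_encard]
      exact map_prod ENat.toNatHom _ _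
    rw [key, key]
    exact Finset.prod_congr rfl fun j _ =>
      (S j).regular (g j) (h j) (i j) _ _ _ _ (hxy j) (hxy' j)

/-- The trivial scheme on a set `U` with more than one element: `R 0` is equality and `R 1` is
inequality. -/
def trivialScheme (U : Type*) [Finite U] [Nontrivial U] : AssociationScheme U (Fin 2) where
  R g := if g = 0 then {z | z.1 = z.2} else {z | z.1 ≠ z.2}
  nonempty g := by
    obtain ⟨a, b, hab⟩ := exists_pair_ne U
    by_cases h : g = 0
    · exact ⟨(a, a), by simp [h]⟩
    · exact ⟨(a, b), by simp [h, hab]⟩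
  partition z := by
    by_cases h : z.1 = z.2
    · exact ⟨0, by simp [h], fun g hg => by by_contra h0; simp [h0, h] at hg⟩
    · exact ⟨1, by simp [h], fun g hg => by
        have h0 : g ≠ 0 := fun h0 => by simp [h0, h] at hg
        exact Fin.eq_one_of_ne_zero g h0⟩
  zero := 0
  R_zero := by simp
  star g := g
  R_star g := by
    ext z
    by_cases h : g = 0 <;> simp [h, eq_comm]
  regular g h i x y x' y' hxy hxy' := by
    classical
    have hiff : x = y ↔ x' = y' := by
      by_cases h0 : i = 0
      · simp only [h0, if_true, Set.mem_ofPred_eq] at hxy hxy'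
        simp [hxy, hxy']
      · simp only [h0, if_false, Set.mem_ofPred_eq] at hxy hxy'
        simp [hxy, hxy']
    obtain ⟨σ, hx, hy⟩ : ∃ σ : Equiv.Perm U, σ x = x' ∧ σ y = y' := by
      by_cases e : x = y
      · exact ⟨Equiv.swap x x', by simp, by rw [← e, ← hiff.1 e]; simp⟩
      · have e' : x' ≠ y' := fun t => e (hiff.2 t)
        have e2 : Equiv.swap x x' y ≠ x' := fun t => e (by
          have := (Equiv.swap x x').injective (t.trans (Equiv.swap_apply_left x x').symm)
          exact this.symm)
        refine ⟨(Equiv.swap x x').trans (Equiv.swap (Equiv.swap x x' y) y'), ?_, by simp⟩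
        simp [Equiv.swap_apply_of_ne_of_ne e2.symm e']
    rw [← Set.ncard_image_of_injective _ σ.injective]
    congr 1
    ext a
    subst hx hy
    simp only [Set.mem_image, Set.mem_ofPred_eq]
    constructor
    · rintro ⟨b, ⟨hb1, hb2⟩, rfl⟩
      constructor
      · split_ifs at hb1 ⊢ <;> simpa using hb1
      · split_ifs at hb2 ⊢ <;> simpa using hb2
    · rintro ⟨hb1, hb2⟩
      refine ⟨σ.symm a, ⟨?_, ?_⟩, by simp⟩
      · split_ifs at hb1 ⊢ <;> simpa [Equiv.eq_symm_apply] using hb1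
      · split_ifs at hb2 ⊢ <;> simpa [Equiv.symm_apply_eq] using hb2

/-- The factorial scheme: the direct product of the trivial schemes on `U 0, …, U (n - 1)`. -/
def factorialScheme {n : ℕ} (U : Fin n → Type*) [∀ h, Finite (U h)] [∀ h, Nontrivial (U h)] :
    AssociationScheme (∀ h, U h) (Fin n → Fin 2) :=
  directProduct fun h => trivialScheme (U h)

end AssociationScheme

/-!
Semisimplicity forces nonzero valencies in any association scheme. Let `u` be the indicator of the
class of `g` at the base point. The rank one matrix `N = u uᵀ = E_g^* J E_g^*` lies in the Terwilliger
algebra `T`, and for `t ∈ T` one has `N t N = (uᵀ t u) N`. Since `t u` is constant on the classes of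
the base point, `uᵀ t u` is a multiple of the valency `k_g`. If `k_g = 0` in `F`, then `N T N = 0` with
`N ≠ 0`, which is impossible in a semisimple ring
(`AssociationScheme.valency_ne_zero_of_isSemisimpleRing`).

Conversely, `T` is semisimple as soon as the space of functions on `X` is spanned by "thin frames":
families with one (possibly zero) vector for each class of the base point, spanning a zero or simple
`T`-module (`AssociationScheme.isSemisimpleRing_of_span_thinVectors`). Tensor products of thin frames
are thin frames for the direct product of schemes, so the spanning property passes to direct products
(`AssociationScheme.span_thinVectors_directProduct`). For the trivial scheme on `U` with `|U| - 1 ≠ 0`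
in `F`, a function splits into a combination of the indicators of `{x}` and of its complement, which
form one frame, and a function that vanishes at `x` and has sum zero, which is a frame by itself
(`AssociationScheme.span_thinVectors_trivialScheme`).

The two halves meet in the valency of `(1, …, 1)`, which is `∏ h, (|U h| - 1)`.
-/

open Matrix

/-! ### Semisimplicity criteria and multilinear maps -/

/-- A semisimple ring is semiprime: a complement of the left ideal `R a` gives `1 = r a + c`, and
multiplying by `a` on the left puts `a` into the complement. -/
theorem eq_zero_of_mul_mul_eq_zero {R : Type*} [Ring R] [IsSemisimpleRing R] {a : R}
    (h : ∀ r, a * r * a = 0) : a = 0 := by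
  obtain ⟨C, hC⟩ := exists_isCompl (Submodule.span R {a})
  have h1 : (1 : R) ∈ Submodule.span R {a} ⊔ C := by rw [hC.sup_eq_top]; trivial
  obtain ⟨b, hb, c, hc, hbc⟩ := Submodule.mem_sup.1 h1
  obtain ⟨r, rfl⟩ := Submodule.mem_span_singleton.1 hb
  have hac : a = a * c := by
    have := congrArg (a * ·) hbc
    simpa [mul_add, ← mul_assoc, h] using this.symm
  refine Submodule.disjoint_def.1 hC.disjoint a (Submodule.mem_span_singleton_self a) ?_
  rw [hac]
  exact C.smul_mem a hc

/-- A module is semisimple if it is generated by elements `m` each of which can be recovered from any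
of its nonzero multiples: then every `R m` is zero or simple. -/
theorem isSemisimpleModule_of_span_eq_top {R M : Type*} [Ring R] [AddCommGroup M] [Module R M]
    {s : Set M} (hs : Submodule.span R s = ⊤)
    (h : ∀ m ∈ s, ∀ r : R, r • m ≠ 0 → ∃ r' : R, r' • r • m = m) :
    IsSemisimpleModule R M := by
  have key : ∀ m ∈ s \ {0}, IsSemisimpleModule R (Submodule.span R {m}) := by
    rintro m ⟨hm, h0⟩
    have : IsSimpleModule R (Submodule.span R {m}) := by
      rw [isSimpleModule_iff_toSpanSingleton_surjective]
      refine ⟨⟨⟨m, Submodule.mem_span_singleton_self m⟩, 0,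
        fun e => h0 (congrArg Subtype.val e)⟩, ?_⟩
      rintro ⟨y, hy⟩ hy0 ⟨z, hz⟩
      obtain ⟨r, rfl⟩ := Submodule.mem_span_singleton.1 hy
      obtain ⟨q, rfl⟩ := Submodule.mem_span_singleton.1 hz
      obtain ⟨r', hr'⟩ := h m hm r fun e => hy0 (Subtype.ext e)
      exact ⟨q * r', Subtype.ext (by simp [mul_smul, hr'])⟩
    infer_instance
  have := isSemisimpleModule_biSup_of_isSemisimpleModule_submodule key
  rw [← Submodule.span_eq_iSup_of_singleton_spans, Submodule.span_sdiff_singleton_zero, hs] at this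
  exact IsSemisimpleModule.congr Submodule.topEquiv.symm

/-- A multilinear map that sends `∏ i, B i` into `W` sends the product of the spans of the `B i`
into `W`. -/
theorem MultilinearMap.map_mem_of_forall_mem_span {R ι N : Type*} {M : ι → Type*} [Finite ι]
    [CommRing R] [∀ i, AddCommGroup (M i)] [∀ i, Module R (M i)] [AddCommGroup N] [Module R N]
    (m : MultilinearMap R M N) {B : ∀ i, Set (M i)} {W : Submodule R N}
    (hW : ∀ f, (∀ i, f i ∈ B i) → m f ∈ W) {f : ∀ i, M i}
    (hf : ∀ i, f i ∈ Submodule.span R (B i)) : m f ∈ W := by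
  classical
  cases nonempty_fintype ι
  suffices H : ∀ (s : Finset ι) (f : ∀ i, M i), (∀ i ∈ s, f i ∈ Submodule.span R (B i)) →
      (∀ i ∉ s, f i ∈ B i) → m f ∈ W from
    H Finset.univ f (fun i _ => hf i) (fun i hi => absurd (Finset.mem_univ i) hi)
  intro s
  induction s using Finset.induction with
  | empty => exact fun f _ hf => hW f fun i => hf i (by simp)
  | insert a s ha ih =>
    intro f hf hf'
    have hle : Submodule.span R (B a) ≤ W.comap (m.toLinearMap f a) := by
      rw [Submodule.span_le]
      intro b hb
      refine ih _ (fun i hi => ?_) (fun i hi => ?_)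
      · rw [Function.update_of_ne (ne_of_mem_of_not_mem hi ha)]
        exact hf i (Finset.mem_insert_of_mem hi)
      · by_cases hia : i = a
        · subst hia; simpa using hb
        · rw [Function.update_of_ne hia]
          exact hf' i (by simp [hia, hi])
    simpa using hle (hf a (Finset.mem_insert_self a s))

namespace AssociationScheme

/-! ### Relation classes and valencies -/

section Relations

variable {X E : Type*} [Finite X] [Finite E] (S : AssociationScheme X E) (x : X)

theorem mem_R_unique {z : X × X} {g h : E} (hg : z ∈ S.R g) (hh : z ∈ S.R h) : g = h :=
  (S.partition z).unique hg hh

/-- The valency of `g` is the size of the class `{a | (x, a) ∈ R g}` at any base point `x`. -/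
theorem valency_eq (g : E) : S.valency g = {a | (x, a) ∈ S.R g}.ncard := by
  have hx : (x, x) ∈ S.R S.zero := by rw [S.R_zero]; rfl
  rw [valency, S.intersectionNumber_eq _ _ _ hx, S.R_star]
  simp

theorem exists_mem_R (g : E) : ∃ y, (x, y) ∈ S.R g := by
  by_contra! H
  have h0 : S.valency g = 0 := by rw [S.valency_eq x]; simp [H]
  obtain ⟨⟨a, b⟩, hab⟩ := S.nonempty g
  rw [S.valency_eq a, Set.ncard_eq_zero] at h0
  exact (h0 ▸ hab : b ∈ (∅ : Set X))

end Relations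

/-! ### Functions constant on the relation classes of the base point -/

section Radial

variable {X E : Type*} [Fintype X] [Finite E] (F : Type*) [Field F]
  (S : AssociationScheme X E) (x : X)

/-- The functions `f` whose value `f y` depends only on the relation containing `(x, y)`. They form
the primary module of the Terwilliger algebra. -/
def radialFunctions : Submodule F (X → F) where
  carrier := {f | ∀ g y y', (x, y) ∈ S.R g → (x, y') ∈ S.R g → f y = f y'}
  add_mem' ha hb g y y' h h' := by simp [ha g y y' h h', hb g y y' h h']
  zero_mem' g y y' h h' := rfl
  smul_mem' c f hf g y y' h h' := by simp [hf g y y' h h']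

open Classical in
/-- The value of `A_g f` at `y` is a combination of intersection numbers, so it depends only on the
relation containing `(x, y)`. -/
theorem adjacencyMatrix_mulVec_mem_radialFunctions (g : E) {f : X → F}
    (hf : f ∈ S.radialFunctions F x) :
    S.adjacencyMatrix F g *ᵥ f ∈ S.radialFunctions F x := by
  have := Fintype.ofFinite E
  choose r hr using fun z => (S.partition z).exists
  have hc : ∃ c : E → F, ∀ y h, (x, y) ∈ S.R h → f y = c h := by
    refine ⟨fun h => if H : ∃ y, (x, y) ∈ S.R h then f H.choose else 0, fun y h hy => ?_⟩
    have H : ∃ y, (x, y) ∈ S.R h := ⟨y, hy⟩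
    simp only [H, dif_pos]
    exact hf h _ _ hy H.choose_spec
  obtain ⟨c, hc⟩ := hc
  have key : ∀ y, (S.adjacencyMatrix F g *ᵥ f) y =
      ∑ h, c h * ({a | (x, a) ∈ S.R h ∧ (a, y) ∈ S.R (S.star g)}.ncard : F) := by
    intro y
    have e : ∀ h, c h * ({a | (x, a) ∈ S.R h ∧ (a, y) ∈ S.R (S.star g)}.ncard : F) =
        ∑ a, if (x, a) ∈ S.R h then (if (y, a) ∈ S.R g then c h else 0) else 0 := by
      intro h
      rw [Set.ncard_eq_toFinset_card', mul_comm, ← nsmul_eq_mul, ← Finset.sum_const,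
        ← Finset.sum_filter, ← Finset.sum_filter]
      refine Finset.sum_congr ?_ fun _ _ => rfl
      ext a
      simp [S.R_star]
    simp_rw [e]
    rw [Finset.sum_comm]
    refine Finset.sum_congr rfl fun a _ => ?_
    rw [Finset.sum_eq_single (r (x, a))]
    · simp [adjacencyMatrix, hr (x, a), hc a _ (hr (x, a))]
    · intro b _ hb
      rw [if_neg fun h => hb (S.mem_R_unique h (hr _))]
    · simp
  intro i y y' hy hy'
  rw [key, key]
  exact Finset.sum_congr rfl fun h _ => by rw [S.regular h (S.star g) i x y x y' hy hy']

open Classical in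
/-- The sum of a radial function over the class of `g` is a multiple of the valency of `g`. -/
theorem exists_sum_eq_valency_mul (g : E) {f : X → F} (hf : f ∈ S.radialFunctions F x) :
    ∃ c, ∑ y, (if (x, y) ∈ S.R g then f y else 0) = S.valency g * c := by
  rw [S.valency_eq x, Set.ncard_eq_toFinset_card', ← Finset.sum_filter]
  by_cases H : ∃ y, (x, y) ∈ S.R g
  · obtain ⟨z, hz⟩ := H
    refine ⟨f z, ?_⟩
    rw [Finset.sum_congr rfl (g := fun _ => f z) fun y hy => hf g y z (by simpa using hy) hz,
      Finset.sum_const, nsmul_eq_mul, Set.toFinset_ofPred]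
  · push Not at H
    exact ⟨0, by simp [H]⟩

end Radial

/-! ### Necessity of nonzero valencies -/

section Terwilliger

variable {X E : Type*} [Fintype X] [DecidableEq X] [Finite E] (F : Type*) [Field F]
  (S : AssociationScheme X E) (x : X)

theorem adjacencyMatrix_mem (g : E) : S.adjacencyMatrix F g ∈ S.terwilligerAlgebra F x :=
  Algebra.subset_adjoin (Or.inl ⟨g, rfl⟩)

theorem dualIdempotent_mem (g : E) : S.dualIdempotent F x g ∈ S.terwilligerAlgebra F x :=
  Algebra.subset_adjoin (Or.inr ⟨g, rfl⟩)

variable {F x} in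
/-- A subspace of functions stable under the generators is stable under the Terwilliger algebra. -/
theorem mulVec_mem_of_mem_terwilligerAlgebra {N : Submodule F (X → F)}
    (hA : ∀ g, ∀ v ∈ N, S.adjacencyMatrix F g *ᵥ v ∈ N)
    (hE : ∀ g, ∀ v ∈ N, S.dualIdempotent F x g *ᵥ v ∈ N)
    {t : Matrix X X F} (ht : t ∈ S.terwilligerAlgebra F x) {v : X → F} (hv : v ∈ N) :
    t *ᵥ v ∈ N := by
  rw [terwilligerAlgebra] at ht
  induction ht using Algebra.adjoin_induction generalizing v with
  | mem t ht =>
    obtain ⟨g, rfl⟩ | ⟨g, rfl⟩ := ht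
    exacts [hA g v hv, hE g v hv]
  | algebraMap r =>
    rw [Algebra.algebraMap_eq_smul_one, smul_mulVec, one_mulVec]
    exact N.smul_mem r hv
  | add a b _ _ iha ihb => rw [add_mulVec]; exact N.add_mem (iha hv) (ihb hv)
  | mul a b _ _ iha ihb => rw [← mulVec_mulVec]; exact iha (ihb hv)

theorem dualIdempotent_mulVec (g : E) (f : X → F) (y : X) [Decidable ((x, y) ∈ S.R g)] :
    (S.dualIdempotent F x g *ᵥ f) y = if (x, y) ∈ S.R g then f y else 0 := by
  classical
  simp [dualIdempotent, mulVec_diagonal]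

/-- The all-ones matrix is the sum of the adjacency matrices. -/
theorem allOnes_mem : (Matrix.of fun _ _ => 1 : Matrix X X F) ∈ S.terwilligerAlgebra F x := by
  classical
  have := Fintype.ofFinite E
  have e : (Matrix.of fun _ _ => 1 : Matrix X X F) = ∑ g, S.adjacencyMatrix F g := by
    ext y z
    obtain ⟨g, hg, hu⟩ := S.partition (y, z)
    rw [Matrix.sum_apply, Finset.sum_eq_single g]
    · simp [adjacencyMatrix, hg]
    · intro h _ hh
      simpa [adjacencyMatrix] using fun h' => hh (hu h h')
    · simp
  rw [e]
  exact sum_mem fun g _ => S.adjacencyMatrix_mem F x g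

variable {F x} in
/-- With `u` the indicator of the class of `g`, the matrix `N = u uᵀ` lies in the algebra and
`N t N = (uᵀ t u) N`. The function `t u` is radial, so the scalar `uᵀ t u` is a multiple of the
valency of `g`; if that vanished, `N` would violate semiprimeness. -/
theorem valency_ne_zero_of_isSemisimpleRing [IsSemisimpleRing (S.terwilligerAlgebra F x)]
    (g : E) : (S.valency g : F) ≠ 0 := by
  classical
  intro h0
  let u : X → F := fun y => if (x, y) ∈ S.R g then 1 else 0
  have hu : u ∈ S.radialFunctions F x := by
    intro h y y' hy hy'
    have : (x, y) ∈ S.R g ↔ (x, y') ∈ S.R g :=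
      ⟨fun k => S.mem_R_unique hy k ▸ hy', fun k => S.mem_R_unique hy' k ▸ hy⟩
    simp [u, this]
  have hmem : vecMulVec u u ∈ S.terwilligerAlgebra F x := by
    -- `N = E_g^* J E_g^*` with `J` the all-ones matrix
    have e : vecMulVec u u = S.dualIdempotent F x g * (Matrix.of fun _ _ => 1) *
        S.dualIdempotent F x g := by
      ext y z
      simp [dualIdempotent, vecMulVec_apply, u, Matrix.mul_diagonal, Matrix.diagonal_mul]
    rw [e]
    exact mul_mem (mul_mem (S.dualIdempotent_mem F x g) (S.allOnes_mem F x))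
      (S.dualIdempotent_mem F x g)
  -- `N t N = 0` for every `t` in the algebra, so `N = 0` by semiprimeness.
  have hzero : (⟨vecMulVec u u, hmem⟩ : S.terwilligerAlgebra F x) = 0 := by
    refine eq_zero_of_mul_mul_eq_zero fun t => Subtype.ext ?_
    have ht : (t : Matrix X X F) *ᵥ u ∈ S.radialFunctions F x := by
      refine S.mulVec_mem_of_mem_terwilligerAlgebra
        (fun h v hv => S.adjacencyMatrix_mulVec_mem_radialFunctions F x h hv) ?_ t.2 hu
      intro h v hv i y y' hy hy'
      have : (x, y) ∈ S.R h ↔ (x, y') ∈ S.R h :=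
        ⟨fun k => S.mem_R_unique hy k ▸ hy', fun k => S.mem_R_unique hy' k ▸ hy⟩
      simp only [dualIdempotent_mulVec, this, hv i y y' hy hy']
    obtain ⟨c, hc⟩ := S.exists_sum_eq_valency_mul F x g ht
    have hd : u ⬝ᵥ (t : Matrix X X F) *ᵥ u = 0 := by
      simpa [dotProduct, u, h0] using hc
    change vecMulVec u u * (t : Matrix X X F) * vecMulVec u u = 0
    rw [mul_assoc, mul_vecMulVec, vecMulVec_mul_vecMulVec, hd]
    simp
  obtain ⟨y, hy⟩ := S.exists_mem_R x g
  have := congrFun (congrFun (congrArg Subtype.val hzero) y) y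
  simp [vecMulVec_apply, u, hy] at this

end Terwilliger

/-! ### Thin frames and a sufficient condition for semisimplicity -/

section ThinFrame

variable {X E : Type*} [Fintype X] [DecidableEq X] [Finite E] {F : Type*} [Field F]
  (S : AssociationScheme X E) (x : X)

/-- A thin frame: a family `w`, with `w i` supported on the class of `i` at the base point `x`, whose
span is a submodule of `X → F` for the Terwilliger algebra, and in which any nonzero member is taken
to a nonzero multiple of any other by some `E_j^* A_g`. Members are allowed to vanish, so a thin
frame spans either zero or a simple module meeting every class in dimension at most one. -/
structure IsThinFrame (w : E → X → F) : Prop where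
  adjacencyMatrix_mulVec_mem : ∀ g i,
    S.adjacencyMatrix F g *ᵥ w i ∈ Submodule.span F (Set.range w)
  dualIdempotent_mulVec_self : ∀ i, S.dualIdempotent F x i *ᵥ w i = w i
  exists_adjacencyMatrix : ∀ i j, w i ≠ 0 → w j ≠ 0 → ∃ g, ∃ c : F, c ≠ 0 ∧
    S.dualIdempotent F x j *ᵥ S.adjacencyMatrix F g *ᵥ w i = c • w j

variable (F) in
/-- The functions occurring as members of thin frames. -/
def thinVectors : Set (X → F) :=
  {v | ∃ w : E → X → F, S.IsThinFrame x w ∧ v ∈ Set.range w}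

variable {S x}

theorem IsThinFrame.dualIdempotent_mulVec [DecidableEq E] {w : E → X → F}
    (hw : S.IsThinFrame x w) (i j : E) :
    S.dualIdempotent F x j *ᵥ w i = if j = i then w i else 0 := by
  classical
  split_ifs with h
  · rw [h, hw.dualIdempotent_mulVec_self]
  · rw [← hw.dualIdempotent_mulVec_self i]
    ext y
    simp only [AssociationScheme.dualIdempotent_mulVec, Pi.zero_apply]
    split_ifs with h1 h2
    · exact absurd (S.mem_R_unique h1 h2) h
    all_goals rfl

theorem IsThinFrame.mulVec_mem {w : E → X → F} (hw : S.IsThinFrame x w)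
    {t : Matrix X X F} (ht : t ∈ S.terwilligerAlgebra F x) (i : E) :
    t *ᵥ w i ∈ Submodule.span F (Set.range w) := by
  classical
  refine S.mulVec_mem_of_mem_terwilligerAlgebra (fun g v hv => ?_) (fun g v hv => ?_) ht
    (Submodule.subset_span ⟨i, rfl⟩)
  · have : Submodule.span F (Set.range w) ≤
        (Submodule.span F (Set.range w)).comap (S.adjacencyMatrix F g).mulVecLin := by
      rw [Submodule.span_le]
      rintro _ ⟨i, rfl⟩
      exact hw.adjacencyMatrix_mulVec_mem g i
    exact this hv
  · have : Submodule.span F (Set.range w) ≤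
        (Submodule.span F (Set.range w)).comap (S.dualIdempotent F x g).mulVecLin := by
      rw [Submodule.span_le]
      rintro _ ⟨i, rfl⟩
      simp only [Submodule.comap_coe, Set.mem_preimage, mulVecLin_apply, SetLike.mem_coe,
        hw.dualIdempotent_mulVec]
      split_ifs
      · exact Submodule.subset_span ⟨i, rfl⟩
      · exact zero_mem _
    exact this hv

/-- A member of a thin frame is recovered from any nonzero multiple `t w_i`: some component
`E_j^* t w_i` is a nonzero multiple of `w_j`, which is then moved back to `w_i`. -/
theorem IsThinFrame.exists_mulVec_eq {w : E → X → F} (hw : S.IsThinFrame x w)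
    {t : Matrix X X F} (ht : t ∈ S.terwilligerAlgebra F x) {i : E} (h0 : t *ᵥ w i ≠ 0) :
    ∃ s ∈ S.terwilligerAlgebra F x, s *ᵥ t *ᵥ w i = w i := by
  classical
  have := Fintype.ofFinite E
  obtain ⟨c, hc⟩ := (Submodule.mem_span_range_iff_exists_fun F).1 (hw.mulVec_mem ht i)
  have hi : w i ≠ 0 := fun h => h0 (by simp [h])
  obtain ⟨j, -, hj⟩ := Finset.exists_ne_zero_of_sum_ne_zero (hc ▸ h0)
  have hcj : c j ≠ 0 := fun h => hj (by simp [h])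
  have hwj : w j ≠ 0 := fun h => hj (by simp [h])
  obtain ⟨g, d, hd, hgd⟩ := hw.exists_adjacencyMatrix j i hwj hi
  have hE : S.dualIdempotent F x j *ᵥ t *ᵥ w i = c j • w j := by
    rw [← hc, ← mulVecLin_apply, map_sum, Finset.sum_eq_single j]
    · simp [hw.dualIdempotent_mulVec]
    · intro b _ hb
      simp [hw.dualIdempotent_mulVec, hb.symm]
    · simp
  refine ⟨(c j * d)⁻¹ • (S.dualIdempotent F x i * S.adjacencyMatrix F g * S.dualIdempotent F x j),
    Subalgebra.smul_mem _ (mul_mem (mul_mem (S.dualIdempotent_mem F x i)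
      (S.adjacencyMatrix_mem F x g)) (S.dualIdempotent_mem F x j)) _, ?_⟩
  rw [smul_mulVec, ← mulVec_mulVec, ← mulVec_mulVec, hE, mulVec_smul, mulVec_smul, hgd, smul_smul,
    smul_smul, mul_assoc, inv_mul_cancel₀ (mul_ne_zero hcj hd), one_smul]

/-- If thin vectors span `X → F`, the full matrix algebra, as a left module over the Terwilliger
algebra, is generated by the matrices `v zᵀ` with `v` thin, hence is semisimple; the Terwilliger
algebra is one of its submodules. -/
theorem isSemisimpleRing_of_span_thinVectors
    (h : Submodule.span F (S.thinVectors F x) = ⊤) :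
    IsSemisimpleRing (S.terwilligerAlgebra F x) := by
  have : IsSemisimpleModule (S.terwilligerAlgebra F x) (Matrix X X F) := by
    refine isSemisimpleModule_of_span_eq_top
      (s := {m | ∃ v ∈ S.thinVectors F x, ∃ z, m = vecMulVec v z}) ?_ ?_
    · rw [eq_top_iff]
      rintro m -
      have hv : ∀ z v : X → F, vecMulVec v z ∈ Submodule.span (S.terwilligerAlgebra F x)
          {m | ∃ v ∈ S.thinVectors F x, ∃ z, m = vecMulVec v z} := by
        intro z v
        have hv : v ∈ Submodule.span F (S.thinVectors F x) := by rw [h]; trivial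
        induction hv using Submodule.span_induction with
        | mem v hv => exact Submodule.subset_span ⟨v, hv, z, rfl⟩
        | zero => simp
        | add a b _ _ ha hb => rw [add_vecMulVec]; exact add_mem ha hb
        | smul c a _ ha => rw [smul_vecMulVec]; exact Submodule.smul_of_tower_mem _ c ha
      have hm : m = ∑ z, vecMulVec (m.col z) (Pi.single z 1) := by
        ext a b
        simp [Matrix.sum_apply, vecMulVec_apply, Pi.single_apply]
      rw [hm]
      exact sum_mem fun z _ => hv _ _
    · rintro _ ⟨v, ⟨w, hw, i, rfl⟩, z, rfl⟩ ⟨t, ht⟩ h0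
      have h0' : t * vecMulVec (w i) z ≠ 0 := h0
      rw [mul_vecMulVec] at h0'
      obtain ⟨s, hs, e⟩ := hw.exists_mulVec_eq ht fun h => h0' (by rw [h, zero_vecMulVec])
      refine ⟨⟨s, hs⟩, ?_⟩
      change s * (t * vecMulVec (w i) z) = _
      rw [mul_vecMulVec, mul_vecMulVec, e]
  exact IsSemisimpleModule.of_injective
    ({ toFun := Subtype.val, map_add' := fun _ _ => rfl, map_smul' := fun _ _ => rfl } :
      S.terwilligerAlgebra F x →ₗ[S.terwilligerAlgebra F x] Matrix X X F) Subtype.val_injective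

end ThinFrame

/-! ### Pure tensors and direct products -/

section PureTensor

variable {ι : Type*} [Fintype ι] (X : ι → Type*) (F : Type*) [Field F]

/-- The product function `y ↦ ∏ h, f h (y h)`, as a multilinear map in `f`. It realizes the
isomorphism of the tensor product of the spaces `X h → F` with the functions on `∀ h, X h`. -/
noncomputable def pureTensor : MultilinearMap F (fun h => X h → F) ((∀ h, X h) → F) :=
  MultilinearMap.pi fun y =>
    (MultilinearMap.mkPiAlgebra F ι F).compLinearMap fun h => LinearMap.proj (y h)

variable {X}

theorem pureTensor_apply (f : ∀ h, X h → F) (y : ∀ h, X h) :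
    pureTensor X F f y = ∏ h, f h (y h) := by
  simp [pureTensor]

/-- The Kronecker product of matrices acts factorwise on pure tensors. -/
theorem pureTensor_mulVec [DecidableEq ι] [∀ h, Fintype (X h)]
    (M : ∀ h, Matrix (X h) (X h) F) (f : ∀ h, X h → F) :
    (Matrix.of fun y z => ∏ h, M h (y h) (z h)) *ᵥ pureTensor X F f =
      pureTensor X F fun h => M h *ᵥ f h := by
  ext y
  simp [mulVec, dotProduct, pureTensor_apply, ← Finset.prod_mul_distrib, Fintype.prod_sum]

end PureTensor

section DirectProduct

variable {ι : Type*} [Fintype ι] [DecidableEq ι] {X E : ι → Type*} [∀ h, Fintype (X h)]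
  [∀ h, Finite (E h)] (F : Type*) [Field F]
  (S : ∀ h, AssociationScheme (X h) (E h)) (x : ∀ h, X h)

theorem directProduct_adjacencyMatrix_mulVec (g : ∀ h, E h) (f : ∀ h, X h → F) :
    (directProduct S).adjacencyMatrix F g *ᵥ pureTensor X F f =
      pureTensor X F fun h => (S h).adjacencyMatrix F (g h) *ᵥ f h := by
  classical
  rw [← pureTensor_mulVec]
  congr 1
  ext y z
  simp only [adjacencyMatrix, of_apply, Fintype.prod_ite_zero, Finset.prod_const_one]
  exact if_congr Iff.rfl rfl rfl

variable [∀ h, DecidableEq (X h)]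

theorem directProduct_dualIdempotent_mulVec (g : ∀ h, E h) (f : ∀ h, X h → F) :
    (directProduct S).dualIdempotent F x g *ᵥ pureTensor X F f =
      pureTensor X F fun h => (S h).dualIdempotent F (x h) (g h) *ᵥ f h := by
  classical
  ext y
  simp only [dualIdempotent_mulVec, pureTensor_apply, Fintype.prod_ite_zero]
  exact if_congr Iff.rfl rfl rfl

theorem IsThinFrame.directProduct {w : ∀ h, E h → X h → F}
    (hw : ∀ h, (S h).IsThinFrame (x h) (w h)) :
    (directProduct S).IsThinFrame x fun g => pureTensor X F fun h => w h (g h) where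
  adjacencyMatrix_mulVec_mem g i := by
    rw [directProduct_adjacencyMatrix_mulVec]
    refine (pureTensor X F).map_mem_of_forall_mem_span (B := fun h => Set.range (w h))
      (fun f hf => ?_) (fun h => (hw h).adjacencyMatrix_mulVec_mem (g h) (i h))
    choose r hr using hf
    exact Submodule.subset_span ⟨r, by simp [hr]⟩
  dualIdempotent_mulVec_self i := by
    simp [directProduct_dualIdempotent_mulVec, (hw _).dualIdempotent_mulVec_self]
  exists_adjacencyMatrix i j hi hj := by
    have ne : ∀ i : ∀ h, E h, (pureTensor X F fun h => w h (i h)) ≠ 0 → ∀ h, w h (i h) ≠ 0 :=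
      fun i hi h h0 => hi ((pureTensor X F).map_coord_zero h h0)
    choose g c hc hgc using fun h => (hw h).exists_adjacencyMatrix _ _ (ne i hi h) (ne j hj h)
    refine ⟨g, ∏ h, c h, Finset.prod_ne_zero_iff.2 fun h _ => hc h, ?_⟩
    rw [directProduct_adjacencyMatrix_mulVec, directProduct_dualIdempotent_mulVec]
    simp only [hgc, MultilinearMap.map_smul_univ]

theorem span_thinVectors_directProduct
    (hS : ∀ h, Submodule.span F ((S h).thinVectors F (x h)) = ⊤) :
    Submodule.span F ((directProduct S).thinVectors F x) = ⊤ := by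
  have hp : ∀ f : ∀ h, X h → F,
      pureTensor X F f ∈ Submodule.span F ((directProduct S).thinVectors F x) := by
    intro f
    refine (pureTensor X F).map_mem_of_forall_mem_span
      (B := fun h => (S h).thinVectors F (x h)) (fun f hf => ?_) (fun h => by rw [hS h]; trivial)
    choose w hw i hi using hf
    exact Submodule.subset_span ⟨_, IsThinFrame.directProduct F S x hw, i, by simp [hi]⟩
  rw [eq_top_iff, ← (Pi.basisFun F (∀ h, X h)).span_eq, Submodule.span_le]
  rintro _ ⟨y, rfl⟩
  rw [SetLike.mem_coe]
  convert! hp fun h => Pi.single (y h) 1 using 1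
  ext z
  simp [pureTensor_apply, Pi.single_apply, Fintype.prod_ite_zero, funext_iff]

end DirectProduct

/-! ### Trivial schemes -/

section TrivialScheme

variable {U : Type*} [Fintype U] [DecidableEq U] [Nontrivial U] {F : Type*} [Field F]

theorem trivialScheme_adjacencyMatrix_zero_mulVec (f : U → F) :
    (trivialScheme U).adjacencyMatrix F 0 *ᵥ f = f := by
  classical
  ext y
  simp [adjacencyMatrix, trivialScheme, mulVec, dotProduct]

theorem trivialScheme_adjacencyMatrix_one_mulVec (f : U → F) (y : U) :
    ((trivialScheme U).adjacencyMatrix F 1 *ᵥ f) y = ∑ z, f z - f y := by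
  classical
  have e : ∀ z, (if y = z then 0 else f z) = f z - if y = z then f z else 0 := by
    intro z; split_ifs <;> simp
  simp [adjacencyMatrix, trivialScheme, mulVec, dotProduct, e]

theorem trivialScheme_dualIdempotent_zero_mulVec (x : U) (f : U → F) (y : U) :
    ((trivialScheme U).dualIdempotent F x 0 *ᵥ f) y = if x = y then f y else 0 := by
  classical
  rw [dualIdempotent_mulVec]
  exact if_congr (by simp [trivialScheme]) rfl rfl

theorem trivialScheme_dualIdempotent_one_mulVec (x : U) (f : U → F) (y : U) :
    ((trivialScheme U).dualIdempotent F x 1 *ᵥ f) y = if x = y then 0 else f y := by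
  classical
  rw [dualIdempotent_mulVec, ← ite_not]
  exact if_congr (by simp [trivialScheme]) rfl rfl

/-- The primary frame: the indicators of `{x}` and of its complement. Moving from the second to the
first costs the factor `|U| - 1`, so this is where the valency has to be nonzero. -/
theorem isThinFrame_trivialScheme_primary (x : U) (hk : ((Fintype.card U - 1 : ℕ) : F) ≠ 0) :
    (trivialScheme U).IsThinFrame x
      ![fun y => if x = y then (1 : F) else 0, fun y => if x = y then 0 else 1] := by
  have hk' : (Fintype.card U : F) - 1 ≠ 0 := by
    rwa [Nat.cast_sub Fintype.card_pos, Nat.cast_one] at hk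
  have sum1 : ∑ z : U, (if x = z then (0 : F) else 1) = Fintype.card U - 1 := by
    have : ∀ z : U, (if x = z then (0 : F) else 1) = 1 - if x = z then 1 else 0 := by
      intro z; split_ifs <;> simp
    simp [this]
  refine ⟨?_, ?_, ?_⟩
  · have key : ∀ v : U → F, (∃ a b : F, ∀ y, v y = if x = y then a else b) →
        v ∈ Submodule.span F (Set.range
          ![fun y => if x = y then (1 : F) else 0, fun y => if x = y then 0 else 1]) := by
      rintro v ⟨a, b, h⟩
      rw [Submodule.mem_span_range_iff_exists_fun]
      refine ⟨![a, b], funext fun y => ?_⟩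
      by_cases hy : x = y <;> simp [h, hy]
    intro g i
    refine key _ ?_
    fin_cases g <;> fin_cases i
    · exact ⟨1, 0, fun y => by simp [trivialScheme_adjacencyMatrix_zero_mulVec]⟩
    · exact ⟨0, 1, fun y => by simp [trivialScheme_adjacencyMatrix_zero_mulVec]⟩
    · refine ⟨0, 1, fun y => ?_⟩
      by_cases hy : x = y <;> simp [trivialScheme_adjacencyMatrix_one_mulVec, hy]
    · refine ⟨Fintype.card U - 1, Fintype.card U - 1 - 1, fun y => ?_⟩
      by_cases hy : x = y <;> simp [trivialScheme_adjacencyMatrix_one_mulVec, hy, ← sum1]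
  · intro i
    ext y
    fin_cases i <;> by_cases hy : x = y <;>
      simp [trivialScheme_dualIdempotent_zero_mulVec, trivialScheme_dualIdempotent_one_mulVec, hy]
  · intro i j _ _
    fin_cases i <;> fin_cases j
    · refine ⟨0, 1, one_ne_zero, funext fun y => ?_⟩
      by_cases hy : x = y <;> simp [trivialScheme_adjacencyMatrix_zero_mulVec,
        trivialScheme_dualIdempotent_zero_mulVec, hy]
    · refine ⟨1, 1, one_ne_zero, funext fun y => ?_⟩
      by_cases hy : x = y <;> simp [trivialScheme_adjacencyMatrix_one_mulVec,
        trivialScheme_dualIdempotent_one_mulVec, hy]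
    · refine ⟨1, Fintype.card U - 1, hk', funext fun y => ?_⟩
      by_cases hy : x = y <;> simp [trivialScheme_adjacencyMatrix_one_mulVec,
        trivialScheme_dualIdempotent_zero_mulVec, hy, ← sum1]
    · refine ⟨0, 1, one_ne_zero, funext fun y => ?_⟩
      by_cases hy : x = y <;> simp [trivialScheme_adjacencyMatrix_zero_mulVec,
        trivialScheme_dualIdempotent_one_mulVec, hy]

/-- The non-primary frames: a function vanishing at `x` with total sum zero spans a one-dimensional
module, supported on the complement of `x`. -/
theorem isThinFrame_trivialScheme_of_sum_eq_zero (x : U) {q : U → F} (hx : q x = 0)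
    (hq : ∑ y, q y = 0) : (trivialScheme U).IsThinFrame x ![0, q] := by
  have hE : (trivialScheme U).dualIdempotent F x 1 *ᵥ q = q := by
    ext y
    rw [trivialScheme_dualIdempotent_one_mulVec]
    split_ifs with hy
    · rw [← hy, hx]
    · rfl
  have hA : (trivialScheme U).adjacencyMatrix F 1 *ᵥ q = -q := by
    ext y
    simp [trivialScheme_adjacencyMatrix_one_mulVec, hq]
  refine ⟨?_, ?_, ?_⟩
  · have hmem : q ∈ Submodule.span F (Set.range ![0, q]) := Submodule.subset_span ⟨1, rfl⟩
    intro g i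
    fin_cases i
    · simp
    · fin_cases g
      · simpa [trivialScheme_adjacencyMatrix_zero_mulVec] using hmem
      · simpa [hA] using hmem
  · intro i
    fin_cases i
    · simp
    · exact hE
  · intro i j hi hj
    fin_cases i
    · simp at hi
    · fin_cases j
      · simp at hj
      · exact ⟨0, 1, one_ne_zero, by simp [trivialScheme_adjacencyMatrix_zero_mulVec, hE]⟩

theorem span_thinVectors_trivialScheme (x : U) (hk : ((Fintype.card U - 1 : ℕ) : F) ≠ 0) :
    Submodule.span F ((trivialScheme U).thinVectors F x) = ⊤ := by
  have hk' : (Fintype.card U : F) - 1 ≠ 0 := by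
    rwa [Nat.cast_sub Fintype.card_pos, Nat.cast_one] at hk
  rw [eq_top_iff]
  rintro f -
  have h0 := isThinFrame_trivialScheme_primary x hk
  -- `c` is the mean of `f` over the complement of `x`, which makes the remainder `q` sum to zero.
  let c : F := (∑ y, f y - f x) / (Fintype.card U - 1)
  let q : U → F := fun y => if x = y then 0 else f y - c
  have hq : ∑ y, q y = 0 := by
    have : ∀ y, q y = (f y - c) - if x = y then f y - c else 0 := by
      intro y; simp only [q]; split_ifs <;> simp
    simp only [this, Finset.sum_sub_distrib, Finset.sum_ite_eq, Finset.mem_univ, if_true,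
      Finset.sum_const, Finset.card_univ, nsmul_eq_mul]
    simp only [c]
    field_simp
    ring
  have hf : f = f x • (fun y => if x = y then (1 : F) else 0) +
      c • (fun y => if x = y then (0 : F) else 1) + q := by
    ext y
    by_cases hy : x = y
    · subst hy; simp [q]
    · simp [q, hy]
  rw [hf]
  exact add_mem (add_mem
    (Submodule.smul_mem _ _ (Submodule.subset_span ⟨_, h0, 0, rfl⟩))
    (Submodule.smul_mem _ _ (Submodule.subset_span ⟨_, h0, 1, rfl⟩)))
    (Submodule.subset_span
      ⟨_, isThinFrame_trivialScheme_of_sum_eq_zero x (by simp [q]) hq, 1, rfl⟩)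

end TrivialScheme

/-! ### The factorial scheme -/

section FactorialScheme

variable {n : ℕ} (U : Fin n → Type*) [∀ h, Fintype (U h)] [∀ h, Nontrivial (U h)]

/-- The class of `(1, …, 1)` has the largest valency, `∏ h, (|U h| - 1)`. -/
theorem factorialScheme_valency_one :
    (factorialScheme U).valency (fun _ => 1) = ∏ h, (Fintype.card (U h) - 1) := by
  classical
  rw [valency_eq _ fun h => (exists_pair_ne (U h)).choose]
  have e : {a : ∀ h, U h | (fun h => (exists_pair_ne (U h)).choose, a) ∈
      (factorialScheme U).R fun _ => 1} =
      ((Fintype.piFinset fun h => {(exists_pair_ne (U h)).choose}ᶜ : Finset (∀ h, U h)) :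
        Set (∀ h, U h)) := by
    ext a
    simp [factorialScheme, directProduct, trivialScheme, eq_comm]
  rw [e, Set.ncard_coe_finset, Fintype.card_piFinset]
  simp [Finset.card_compl]

end FactorialScheme

end AssociationScheme

open AssociationScheme in
theorem theorem5p20 {F : Type*} [Field F] (p : ℕ) [CharP F p] (n : ℕ) (hn : 1 ≤ n)
    (U : Fin n → Type*) [∀ h, Fintype (U h)] [∀ h, DecidableEq (U h)] [∀ h, Nontrivial (U h)]
    (x : ∀ h, U h) :
    (IsSemisimpleRing ((AssociationScheme.factorialScheme U).terwilligerAlgebra F x) ↔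
      (AssociationScheme.factorialScheme U).IsCoprimeValenced p) ∧
    (IsSemisimpleRing ((AssociationScheme.factorialScheme U).terwilligerAlgebra F x) ↔
      ¬ p ∣ ∏ h, (Fintype.card (U h) - 1)) := by
  have valenced : IsSemisimpleRing ((factorialScheme U).terwilligerAlgebra F x) →
      (factorialScheme U).IsCoprimeValenced p := fun _ g h =>
    (factorialScheme U).valency_ne_zero_of_isSemisimpleRing (x := x) g
      ((CharP.cast_eq_zero_iff F p _).2 h)
  have not_dvd : (factorialScheme U).IsCoprimeValenced p →
      ¬ p ∣ ∏ h, (Fintype.card (U h) - 1) := fun h =>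
    factorialScheme_valency_one U ▸ h fun _ => 1
  have semisimple : ¬ p ∣ ∏ h, (Fintype.card (U h) - 1) →
      IsSemisimpleRing ((factorialScheme U).terwilligerAlgebra F x) := by
    intro h
    rw [← CharP.cast_eq_zero_iff F p, Nat.cast_prod] at h
    exact isSemisimpleRing_of_span_thinVectors
      (span_thinVectors_directProduct F _ x fun i =>
        span_thinVectors_trivialScheme (x i) (Finset.prod_ne_zero_iff.1 h i (Finset.mem_univ i)))
  exact ⟨⟨valenced, semisimple ∘ not_dvd⟩, ⟨not_dvd ∘ valenced, semisimple⟩⟩
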